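/- Let $r,s\ge 3$ and $\ell\ge 1$ be integers with $r$ even and $s$ odd, and let $D_{r,s,\ell}$ be the dumbbell graph, obtained from two vertex-disjoint cycles $C_r$ and $C_s$ by choosing one vertex on each and joining these two vertices by a path of length $\ell$. A complex unit gain graph $\Phi=(D_{r,s,\ell},\varphi)$ assigns to every oriented edge $(u,v)$ of $D_{r,s,\ell}$ a complex number $\varphi(u,v)$ with $|\varphi(u,v)|=1$ and $\varphi(v,u)=\varphi(u,v)^{-1}$. Its adjacency matrix $A(\Phi)$ is the Hermitian matrix with entry $\varphi(u,v)$ if $u$ and $v$ are adjacent and $0$ otherwise, and its energy $E(\Phi)$ is the sum of the absolute values of the eigenvalues of $A(\Phi)$, counted with multiplicity. Let $\gamma_r$ and $\gamma_s$ be the gains of the cycles $C_r$ and $C_s$ in $\Phi$, that is, the products of the gains of the oriented edges met when going once around the cycle (the real part does not depend on the direction or the starting vertex), and put $$\alpha=(-1)^{r/2}\operatorname{Re}(\gamma_r),\qquad \beta=(-1)^{(s+1)/2}\operatorname{Re}(\gamma_s).$$ Theorem. The minimum of $E(\Phi)$ over all complex unit gain graphs $\Phi$ on $D_{r,s,\ell}$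 is attained, and $\Phi$ attains it if and only if $\alpha=1$ and $\beta=0$. -/

import Mathlib

/-- A complex unit gain graph on the simple graph `G`: every oriented edge `u → v` carries a complex
number of modulus one, and reversing the orientation inverts it. -/
structure UnitGainGraph {V : Type*} (G : SimpleGraph V) where
  /-- The gain of an oriented edge. -/
  gain : G.Dart → Circle
  gain_symm : ∀ d : G.Dart, gain d.symm = (gain d)⁻¹

namespace UnitGainGraph

variable {V : Type*} {G : SimpleGraph V}

open Classical in
/-- The Hermitian adjacency matrix: the gain of `u → v` if `u` and `v` are adjacent, otherwise `0`. -/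
noncomputable def adjMatrix (Φ : UnitGainGraph G) : Matrix V V ℂ :=
  Matrix.of fun u v => if h : G.Adj u v then (Φ.gain ⟨(u, v), h⟩ : ℂ) else 0

theorem isHermitian_adjMatrix (Φ : UnitGainGraph G) : Φ.adjMatrix.IsHermitian := by
  ext u v
  simp only [adjMatrix, Matrix.conjTranspose_apply, Matrix.of_apply]
  by_cases h : G.Adj u v
  · have h' : G.Adj v u := h.symm
    have key := Φ.gain_symm ⟨(u, v), h⟩
    have e : (SimpleGraph.Dart.symm ⟨(u, v), h⟩ : G.Dart) = ⟨(v, u), h'⟩ := rfl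
    rw [e] at key
    rw [dif_pos h, dif_pos h', key, Circle.coe_inv_eq_conj]
    simp
  · have h' : ¬ G.Adj v u := fun k => h k.symm
    simp [h, h']

/-- The energy: the sum of the absolute values of the eigenvalues of the adjacency matrix,
counted with multiplicity. -/
noncomputable def energy [Fintype V] [DecidableEq V] (Φ : UnitGainGraph G) : ℝ :=
  ∑ j, |Φ.isHermitian_adjMatrix.eigenvalues j|

end UnitGainGraph

theorem cycleGraph_adj_finRotate {k : ℕ} (hk : 3 ≤ k) (i : Fin k) :
    (SimpleGraph.cycleGraph k).Adj i (finRotate k i) := by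
  obtain ⟨m, rfl⟩ : ∃ m, k = m + 2 := ⟨k - 2, by omega⟩
  rw [finRotate_apply, SimpleGraph.cycleGraph_adj]
  right
  simp

/-- The gain `φ(c₀,c₁) φ(c₁,c₂) ⋯ φ(c_{k-1},c₀)` of a cycle `c₀, c₁, …, c_{k-1}` of `G`, given as a
copy in `G` of the cycle graph on `Fin k` (`finRotate k` is the map `i ↦ i + 1` modulo `k`). -/
noncomputable def UnitGainGraph.cycleGain {V : Type*} {G : SimpleGraph V} (Φ : UnitGainGraph G)
    {k : ℕ} (hk : 3 ≤ k) (c : SimpleGraph.Copy (SimpleGraph.cycleGraph k) G) : Circle :=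
  ∏ i : Fin k, Φ.gain ⟨(c i, c (finRotate k i)), c.toHom.map_adj (cycleGraph_adj_finRotate hk i)⟩

/-- The vertices of the dumbbell graph: those of the cycle `C_r`, the `ℓ - 1` inner vertices of the
connecting path, and those of the cycle `C_s`. -/
abbrev DumbbellVertex (r s ℓ : ℕ) : Type := Fin r ⊕ Fin (ℓ - 1) ⊕ Fin s

/-- Adjacency in the dumbbell graph: the path of length `ℓ` runs from vertex `0` of `C_r` through the
inner vertices `0, …, ℓ - 2` to vertex `0` of `C_s`; for `ℓ = 1` it is a single edge. -/
def dumbbellAdj (r s ℓ : ℕ) : DumbbellVertex r s ℓ → DumbbellVertex r s ℓ → Prop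
  | .inl i, .inl j => (SimpleGraph.cycleGraph r).Adj i j
  | .inr (.inl i), .inr (.inl j) => (SimpleGraph.pathGraph (ℓ - 1)).Adj i j
  | .inr (.inr i), .inr (.inr j) => (SimpleGraph.cycleGraph s).Adj i j
  | .inl i, .inr (.inl j) => i.val = 0 ∧ j.val = 0
  | .inr (.inl j), .inl i => i.val = 0 ∧ j.val = 0
  | .inr (.inl j), .inr (.inr k) => j.val + 1 = ℓ - 1 ∧ k.val = 0
  | .inr (.inr k), .inr (.inl j) => j.val + 1 = ℓ - 1 ∧ k.val = 0
  | .inl i, .inr (.inr k) => ℓ = 1 ∧ i.val = 0 ∧ k.val = 0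
  | .inr (.inr k), .inl i => ℓ = 1 ∧ i.val = 0 ∧ k.val = 0

/-- The dumbbell graph `D_{r,s,ℓ}` (for `r, s ≥ 3` and `ℓ ≥ 1`): two vertex disjoint cycles `C_r` and
`C_s`, one vertex of each being joined by a path of length `ℓ`. -/
def dumbbellGraph (r s ℓ : ℕ) : SimpleGraph (DumbbellVertex r s ℓ) where
  Adj := dumbbellAdj r s ℓ
  symm := ⟨by
    rintro (i | i | i) (j | j | j) h
    · exact SimpleGraph.Adj.symm (G := SimpleGraph.cycleGraph r) h
    · exact h
    · exact h
    · exact h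
    · exact SimpleGraph.Adj.symm (G := SimpleGraph.pathGraph (ℓ - 1)) h
    · exact h
    · exact h
    · exact h
    · exact SimpleGraph.Adj.symm (G := SimpleGraph.cycleGraph s) h⟩
  loopless := ⟨by
    rintro (i | i | i) h
    · exact (SimpleGraph.cycleGraph r).loopless.irrefl i h
    · exact (SimpleGraph.pathGraph (ℓ - 1)).loopless.irrefl i h
    · exact (SimpleGraph.cycleGraph s).loopless.irrefl i h⟩

/-- The cycle `C_r` of the dumbbell graph. -/
def dumbbellLeftCycle (r s ℓ : ℕ) :
    SimpleGraph.Copy (SimpleGraph.cycleGraph r) (dumbbellGraph r s ℓ) :=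
  ⟨⟨fun i => .inl i, fun h => h⟩, fun _ _ h => Sum.inl_injective h⟩

/-- The cycle `C_s` of the dumbbell graph. -/
def dumbbellRightCycle (r s ℓ : ℕ) :
    SimpleGraph.Copy (SimpleGraph.cycleGraph s) (dumbbellGraph r s ℓ) :=
  ⟨⟨fun i => .inr (.inr i), fun h => h⟩,
    fun _ _ h => Sum.inr_injective (Sum.inr_injective h)⟩

/-- For even `r`: `α = (-1)^{r/2} Re γ_r`, where `γ_r` is the gain of the cycle `C_r`. -/
noncomputable def mixedAlpha {r s ℓ : ℕ} (hr : 3 ≤ r) (Φ : UnitGainGraph (dumbbellGraph r s ℓ)) : ℝ :=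
  (-1) ^ (r / 2) * (Φ.cycleGain hr (dumbbellLeftCycle r s ℓ) : ℂ).re

/-- For odd `s`: `β = (-1)^{(s+1)/2} Re γ_s`, where `γ_s` is the gain of the cycle `C_s`. -/
noncomputable def mixedBeta {r s ℓ : ℕ} (hs : 3 ≤ s) (Φ : UnitGainGraph (dumbbellGraph r s ℓ)) : ℝ :=
  (-1) ^ ((s + 1) / 2) * (Φ.cycleGain hs (dumbbellRightCycle r s ℓ) : ℂ).re

/-! The energy is compared through the characteristic polynomial on the imaginary axis. Eigenvalues
`λ` of a Hermitian matrix are real, so `|det(ix - A)|² = ∏ (x² + λ²)`. If this is pointwise smaller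
for one matrix than for another of the same size at all `x > 0`, integrating logarithms over the
half-line (Coulson's formula) gives the inequality of energies (`sum_abs_le_of_prod_le`,
`sum_abs_lt_of_prod_lt`).

On the dumbbell, `det(ix - A)` depends on the gains only through the real parts of the two cycle
gains. The even cycle contributes `i^r (c - 2α)` and the odd one `i^s (c' - 2βi)`: by parity `α`
shifts a real factor, while `β` is out of phase by a right angle. Attaching the path and crossing
the bridge preserves these phases and creates only nonnegative coefficients, so `|det(ix - A)|² =
((c - 2α)a + pe)² + 4β²((c - 2α)q + pq')²`, with `c > 2` and constants independent of `Φ`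
(`exists_normSq_det_charMat_dumbbell`). Since `α ≤ 1`, both squares are controlled at once: for
every `x > 0` the minimum occurs exactly at `α = 1`, `β = 0`, and this pair is realised by some
gains. -/

/-! ### Comparison of energies by a Coulson-type integral -/

open Filter Topology in
theorem tendsto_mul_log_sq_add_sub (a : ℝ) :
    Tendsto (fun x : ℝ => x * Real.log (x ^ 2 + a ^ 2) - x * Real.log (x ^ 2)) atTop (𝓝 0) := by
  have hlim : Tendsto (fun x : ℝ => a ^ 2 / x) atTop (𝓝 0) :=
    tendsto_const_nhds.div_atTop tendsto_id
  refine tendsto_of_tendsto_of_tendsto_of_le_of_le' tendsto_const_nhds hlim ?_ ?_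
  · filter_upwards [eventually_gt_atTop 0] with x hx
    rw [← mul_sub]
    refine mul_nonneg hx.le (sub_nonneg.2 (Real.log_le_log (by positivity) ?_))
    nlinarith [sq_nonneg a]
  · filter_upwards [eventually_gt_atTop 0] with x hx
    rw [← mul_sub, ← Real.log_div (by positivity) (by positivity)]
    have h := Real.log_le_sub_one_of_pos (x := (x ^ 2 + a ^ 2) / x ^ 2) (by positivity)
    calc x * Real.log ((x ^ 2 + a ^ 2) / x ^ 2)
        ≤ x * ((x ^ 2 + a ^ 2) / x ^ 2 - 1) := mul_le_mul_of_nonneg_left h hx.le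
      _ = a ^ 2 / x := by field_simp; ring

open Filter Topology in
theorem tendsto_abs_mul_arctan (a : ℝ) :
    Tendsto (fun x : ℝ => |a| * Real.arctan (x / |a|)) atTop (𝓝 (|a| * (Real.pi / 2))) := by
  rcases eq_or_ne a 0 with rfl | ha
  · simp
  · have ha' : 0 < |a| := abs_pos.2 ha
    exact ((tendsto_nhds_of_tendsto_nhdsWithin Real.tendsto_arctan_atTop).comp
      (tendsto_id.atTop_div_const ha')).const_mul _

/-- A primitive of `x ↦ log (x ^ 2 + a ^ 2)` on the positive half-line. -/
noncomputable def logSqAddPrimitive (a x : ℝ) : ℝ :=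
  x * Real.log (x ^ 2 + a ^ 2) - 2 * x + 2 * (|a| * Real.arctan (x / |a|))

theorem hasDerivAt_logSqAddPrimitive (a : ℝ) {x : ℝ} (hx : 0 < x) :
    HasDerivAt (logSqAddPrimitive a) (Real.log (x ^ 2 + a ^ 2)) x := by
  have hpos : x ^ 2 + a ^ 2 ≠ 0 := by positivity
  have h1 : HasDerivAt (fun y : ℝ => y ^ 2 + a ^ 2) (2 * x) x := by
    simpa using (hasDerivAt_pow 2 x).add_const (a ^ 2)
  have h2 := (hasDerivAt_id x).mul (h1.log hpos)
  have h3 := ((hasDerivAt_id x).div_const |a|).arctan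
  have h4 := (h2.sub ((hasDerivAt_id x).const_mul 2)).add ((h3.const_mul |a|).const_mul 2)
  refine h4.congr_deriv ?_
  rcases eq_or_ne a 0 with rfl | ha
  · simp; field_simp; ring
  · have ha' : 0 < |a| := abs_pos.2 ha
    have hsq : a ^ 2 = |a| ^ 2 := (sq_abs a).symm
    simp only [id]
    rw [hsq] at hpos ⊢
    have : 1 + (x / |a|) ^ 2 ≠ 0 := by positivity
    field_simp
    ring

theorem continuous_logSqAddPrimitive (a : ℝ) : Continuous (logSqAddPrimitive a) := by
  have h : Continuous fun x : ℝ => x * Real.log (x ^ 2 + a ^ 2) := by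
    -- For `a = 0` the logarithm is singular at the origin; continuity is that of `x log x`.
    rcases eq_or_ne a 0 with rfl | ha
    · have : (fun x : ℝ => x * Real.log (x ^ 2 + 0 ^ 2)) = fun x => 2 * (x * Real.log x) := by
        ext x
        simp [Real.log_pow]
        ring
      rw [this]
      exact Real.continuous_mul_log.const_mul 2
    · refine continuous_id.mul (Continuous.log (by fun_prop) fun x => by positivity)
  unfold logSqAddPrimitive
  exact (h.sub (by fun_prop)).add
    (((Real.continuous_arctan.comp (continuous_id.div_const _)).const_mul _).const_mul _)

theorem logSqAddPrimitive_zero (a : ℝ) : logSqAddPrimitive a 0 = 0 := by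
  simp [logSqAddPrimitive]

section Comparison

variable {ι : Type*} [Fintype ι] (a b : ι → ℝ)

-- The divergent part `x log(x²) - 2x` is the same for every index and cancels, because both
-- families have the same index set. Each arctangent term leaves `2|c| · π/2`.
open Filter Topology in
theorem tendsto_sum_logSqAddPrimitive_sub :
    Tendsto (fun x => ∑ i, logSqAddPrimitive (b i) x - ∑ i, logSqAddPrimitive (a i) x) atTop
      (𝓝 (Real.pi * (∑ i, |b i| - ∑ i, |a i|))) := by
  have h (c : ι → ℝ) : Tendsto (fun x => ∑ i,
      ((x * Real.log (x ^ 2 + c i ^ 2) - x * Real.log (x ^ 2)) +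
        2 * (|c i| * Real.arctan (x / |c i|)))) atTop (𝓝 (∑ i, (0 + 2 * (|c i| * (Real.pi / 2))))) :=
    tendsto_finsetSum _ fun i _ =>
      (tendsto_mul_log_sq_add_sub (c i)).add ((tendsto_abs_mul_arctan (c i)).const_mul 2)
  convert (h b).sub (h a) using 2
  · rw [← Finset.sum_sub_distrib, ← Finset.sum_sub_distrib]
    refine Finset.sum_congr rfl fun i _ => ?_
    simp only [logSqAddPrimitive]
    ring
  · rw [← Finset.sum_sub_distrib, ← Finset.sum_sub_distrib, Finset.mul_sum]
    refine Finset.sum_congr rfl fun i _ => ?_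
    ring

theorem hasDerivAt_sum_logSqAddPrimitive_sub {x : ℝ} (hx : 0 < x) :
    HasDerivAt (fun x => ∑ i, logSqAddPrimitive (b i) x - ∑ i, logSqAddPrimitive (a i) x)
      (Real.log (∏ i, (x ^ 2 + b i ^ 2)) - Real.log (∏ i, (x ^ 2 + a i ^ 2))) x := by
  have h (c : ι → ℝ) : Real.log (∏ i, (x ^ 2 + c i ^ 2)) = ∑ i, Real.log (x ^ 2 + c i ^ 2) :=
    Real.log_prod fun i _ => by positivity
  rw [h, h]
  exact (HasDerivAt.fun_sum fun i _ => hasDerivAt_logSqAddPrimitive (b i) hx).sub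
    (HasDerivAt.fun_sum fun i _ => hasDerivAt_logSqAddPrimitive (a i) hx)

theorem continuous_sum_logSqAddPrimitive_sub :
    Continuous fun x => ∑ i, logSqAddPrimitive (b i) x - ∑ i, logSqAddPrimitive (a i) x :=
  (continuous_finsetSum _ fun i _ => continuous_logSqAddPrimitive (b i)).sub
    (continuous_finsetSum _ fun i _ => continuous_logSqAddPrimitive (a i))

/-- The difference of the summed primitives vanishes at `0`, is monotone because its derivative is
the logarithm of the ratio of the products, and tends to `π` times the difference of the two sums.
-/
theorem sum_abs_le_of_prod_le
    (h : ∀ x : ℝ, 0 < x → ∏ i, (x ^ 2 + a i ^ 2) ≤ ∏ i, (x ^ 2 + b i ^ 2)) :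
    ∑ i, |a i| ≤ ∑ i, |b i| := by
  have hmono := monotoneOn_of_deriv_nonneg (convex_Ici (0 : ℝ))
    (continuous_sum_logSqAddPrimitive_sub a b).continuousOn
    (fun x hx => (hasDerivAt_sum_logSqAddPrimitive_sub a b
      (by simpa using hx)).differentiableAt.differentiableWithinAt)
    (fun x hx => by
      have hx' : 0 < x := by simpa using hx
      rw [(hasDerivAt_sum_logSqAddPrimitive_sub a b hx').deriv, sub_nonneg]
      exact Real.log_le_log (Finset.prod_pos fun i _ => by positivity) (h x hx'))
  have hlim := ge_of_tendsto (b := 0) (tendsto_sum_logSqAddPrimitive_sub a b) (by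
    filter_upwards [Filter.eventually_ge_atTop 0] with x hx
    have := hmono Set.self_mem_Ici hx hx
    simpa [logSqAddPrimitive_zero] using this)
  exact sub_nonneg.1 (nonneg_of_mul_nonneg_right hlim Real.pi_pos)

theorem sum_abs_lt_of_prod_lt
    (h : ∀ x : ℝ, 0 < x → ∏ i, (x ^ 2 + a i ^ 2) < ∏ i, (x ^ 2 + b i ^ 2)) :
    ∑ i, |a i| < ∑ i, |b i| := by
  have hmono := strictMonoOn_of_deriv_pos (convex_Ici (0 : ℝ))
    (continuous_sum_logSqAddPrimitive_sub a b).continuousOn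
    (fun x hx => by
      have hx' : 0 < x := by simpa using hx
      rw [(hasDerivAt_sum_logSqAddPrimitive_sub a b hx').deriv, sub_pos]
      exact Real.log_lt_log (Finset.prod_pos fun i _ => by positivity) (h x hx'))
  -- Passing to the limit loses strictness, so the limit is bounded below by the value at `1`, which
  -- is already positive.
  have h01 := hmono Set.self_mem_Ici (Set.mem_Ici.2 zero_le_one) zero_lt_one
  have hlim := ge_of_tendsto (tendsto_sum_logSqAddPrimitive_sub a b) (by
    filter_upwards [Filter.eventually_ge_atTop 1] with x hx
    exact hmono.monotoneOn (Set.mem_Ici.2 zero_le_one) (Set.mem_Ici.2 (zero_le_one.trans hx)) hx)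
  simp only [logSqAddPrimitive_zero, Finset.sum_const_zero, sub_zero] at h01
  exact sub_pos.1 ((mul_pos_iff_of_pos_left Real.pi_pos).1 (h01.trans_le hlim))

end Comparison

theorem Matrix.IsHermitian.normSq_det_I_mul_sub {ι : Type*} [Fintype ι] [DecidableEq ι]
    {A : Matrix ι ι ℂ} (hA : A.IsHermitian) (x : ℝ) :
    Complex.normSq (Matrix.det (Matrix.scalar ι (Complex.I * x) - A)) =
      ∏ i, (x ^ 2 + hA.eigenvalues i ^ 2) := by
  rw [← Matrix.eval_charpoly, hA.charpoly_eq, Polynomial.eval_prod, map_prod]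
  refine Finset.prod_congr rfl fun i _ => ?_
  simp [Complex.normSq_apply]
  ring

/-! ### Determinants across a bridge and along one vertex -/

namespace Matrix

section Bordered

variable {K : Type*} [Field K]

theorem det_sub_single {κ : Type*} [Fintype κ] [DecidableEq κ] (D : Matrix κ κ K) (v : κ) (t : K) :
    (D - Matrix.single v v t).det = D.det - t * D.adjugate v v := by
  have h : D - Matrix.single v v t = D.updateRow v (D v + (-t) • Pi.single v 1) := by
    ext i j
    rcases eq_or_ne i v with rfl | hi
    · rcases eq_or_ne j i with rfl | hj
      · simp [sub_eq_add_neg]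
      · simp [hj, hj.symm]
    · simp [hi, hi.symm]
  rw [h, det_updateRow_add, det_updateRow_smul, updateRow_eq_self, adjugate_apply]
  ring

/-- Two square blocks joined by a bridge. -/
theorem det_fromBlocks_single {ι κ : Type*} [Fintype ι] [DecidableEq ι] [Fintype κ] [DecidableEq κ]
    (A : Matrix ι ι K) (D : Matrix κ κ K) (u : ι) (v : κ) (b c : K) (hA : A.det ≠ 0) :
    (fromBlocks A (Matrix.single u v b) (Matrix.single v u c) D).det =
      A.det * D.det - b * c * (A.adjugate u u * D.adjugate v v) := by
  let _ : Invertible A := A.invertibleOfIsUnitDet (isUnit_iff_ne_zero.2 hA)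
  have h : Matrix.single v u c * ⅟A * Matrix.single u v b =
      Matrix.single v v (c * (A.det⁻¹ * A.adjugate u u) * b) := by
    rw [single_mul_mul_single, invOf_eq_nonsing_inv, inv_def, Ring.inverse_eq_inv']
    simp
  rw [det_fromBlocks₁₁, h, det_sub_single]
  field_simp

theorem adjugate_fromBlocks_inl_unit {κ : Type*} [Fintype κ] [DecidableEq κ]
    (A : Matrix Unit Unit K) (B : Matrix Unit κ K) (C : Matrix κ Unit K) (D : Matrix κ κ K) :
    (fromBlocks A B C D).adjugate (Sum.inl ()) (Sum.inl ()) = D.det := by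
  have h : (fromBlocks A B C D).updateRow (Sum.inl ()) (Pi.single (Sum.inl ()) 1) =
      fromBlocks 1 0 C D := by
    ext (i | i) (j | j) <;> simp [updateRow_apply]
  rw [adjugate_apply, h, det_fromBlocks_zero₁₂, det_one, one_mul]

/-- Schur complement of the block obtained by deleting index `0`, with the inverse written through
the adjugate; nonvanishing makes that block invertible. -/
theorem det_succ_eq_sub_sum_adjugate {n : ℕ} (M : Matrix (Fin (n + 1)) (Fin (n + 1)) K)
    (hM : (M.submatrix Fin.succ Fin.succ).det ≠ 0) :
    M.det = M 0 0 * (M.submatrix Fin.succ Fin.succ).det -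
      ∑ i, ∑ j, M 0 (Fin.succ i) * (M.submatrix Fin.succ Fin.succ).adjugate i j *
        M (Fin.succ j) 0 := by
  set T := M.submatrix Fin.succ Fin.succ with hT
  let _ : Invertible T := T.invertibleOfIsUnitDet (isUnit_iff_ne_zero.2 hM)
  let e : Fin n ⊕ Unit ≃ Fin (n + 1) :=
    ((finSuccEquiv n).trans (Equiv.optionEquivSumPUnit (Fin n))).symm
  have he : M.submatrix e e = fromBlocks T (of fun i _ => M i.succ 0) (of fun _ j => M 0 j.succ)
      (of fun _ _ => M 0 0) := by
    ext (i | i) (j | j) <;> simp [e, hT]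
  rw [← det_submatrix_equiv_self e M, he, det_fromBlocks₁₁, det_unique (n := Unit),
    invOf_eq_nonsing_inv, inv_def, Ring.inverse_eq_inv']
  have h : ((of fun (_ : Unit) j => M 0 (Fin.succ j)) * (T.det⁻¹ • T.adjugate) *
      (of fun i (_ : Unit) => M (Fin.succ i) 0)) () () =
      T.det⁻¹ * ∑ i, ∑ j, M 0 (Fin.succ i) * T.adjugate i j * M (Fin.succ j) 0 := by
    rw [Finset.sum_comm]
    simp only [mul_apply, of_apply, smul_apply, smul_eq_mul, Finset.mul_sum, Finset.sum_mul]
    refine Finset.sum_congr rfl fun j _ => Finset.sum_congr rfl fun i _ => ?_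
    ring
  rw [sub_apply, PUnit.default_eq_unit, h]
  simp only [of_apply]
  field_simp

end Bordered

end Matrix

/-! ### Paths and cycles on the imaginary axis -/

/-- The matching polynomials of paths, with all signs made positive. -/
noncomputable def pathMatchingPoly (x : ℝ) : ℕ → ℝ
  | 0 => 1
  | 1 => x
  | n + 2 => x * pathMatchingPoly x (n + 1) + pathMatchingPoly x n

theorem pathMatchingPoly_pos {x : ℝ} (hx : 0 < x) : ∀ n, 0 < pathMatchingPoly x n
  | 0 => one_pos
  | 1 => hx
  | n + 2 => add_pos (mul_pos hx (pathMatchingPoly_pos hx (n + 1))) (pathMatchingPoly_pos hx n)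

/-- For even index the constant term is `1`. Applied to index `r - 2`, this yields `c > 2` for the
even cycle. -/
theorem one_le_pathMatchingPoly_two_mul {x : ℝ} (hx : 0 < x) :
    ∀ n, 1 ≤ pathMatchingPoly x (2 * n)
  | 0 => le_rfl
  | n + 1 => (one_le_pathMatchingPoly_two_mul hx n).trans
      (le_add_of_nonneg_left (mul_pos hx (pathMatchingPoly_pos hx _)).le)

namespace Matrix

/-- Tridiagonal matrices with constant diagonal `z` whose symmetric pairs of entries next to the
diagonal have product `1`. -/
structure IsPathLike (z : ℂ) {n : ℕ} (T : Matrix (Fin n) (Fin n) ℂ) : Prop where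
  diag : ∀ i, T i i = z
  far : ∀ i j : Fin n, i.val + 1 < j.val ∨ j.val + 1 < i.val → T i j = 0
  near : ∀ i j : Fin n, i.val + 1 = j.val → T i j * T j i = 1

namespace IsPathLike

variable {z : ℂ} {n : ℕ}

theorem submatrix_succ {T : Matrix (Fin (n + 1)) (Fin (n + 1)) ℂ} (hT : IsPathLike z T) :
    IsPathLike z (T.submatrix Fin.succ Fin.succ) where
  diag i := hT.diag _
  far i j h := hT.far _ _ (by simpa using h)
  near i j h := hT.near _ _ (by simpa using h)

theorem submatrix_castSucc {T : Matrix (Fin (n + 1)) (Fin (n + 1)) ℂ} (hT : IsPathLike z T) :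
    IsPathLike z (T.submatrix Fin.castSucc Fin.castSucc) where
  diag i := hT.diag _
  far i j h := hT.far _ _ (by simpa using h)
  near i j h := hT.near _ _ (by simpa using h)

/-- Only products of opposite entries enter the three-term recurrence, so gains on a path are
invisible; at `ix` the powers of `i` turn its minus sign into a plus. -/
theorem det_eq {x : ℝ} (hx : 0 < x) : ∀ {n : ℕ} {T : Matrix (Fin n) (Fin n) ℂ},
    IsPathLike (Complex.I * x) T → T.det = Complex.I ^ n * pathMatchingPoly x n
  | 0, T, _ => by simp [pathMatchingPoly]
  | 1, T, hT => by simp [pathMatchingPoly, hT.diag]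
  | n + 2, T, hT => by
    have h1 := det_eq hx hT.submatrix_succ
    have h2 := det_eq hx hT.submatrix_succ.submatrix_succ
    have hne : (T.submatrix Fin.succ Fin.succ).det ≠ 0 := by
      rw [h1]
      exact mul_ne_zero (pow_ne_zero _ Complex.I_ne_zero)
        (Complex.ofReal_ne_zero.2 (pathMatchingPoly_pos hx _).ne')
    have h0 (i : Fin n) : T 0 i.succ.succ = 0 := hT.far _ _ (by simp)
    have h0' (i : Fin n) : T i.succ.succ 0 = 0 := hT.far _ _ (by simp)
    have h01 := hT.near 0 (Fin.succ 0) (by simp)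
    have hadj : (T.submatrix Fin.succ Fin.succ).adjugate 0 0 =
        ((T.submatrix Fin.succ Fin.succ).submatrix Fin.succ Fin.succ).det := by
      simp [adjugate_fin_succ_eq_det_submatrix]
    rw [det_succ_eq_sub_sum_adjugate T hne]
    simp only [Fin.sum_univ_succ, h0, h0', zero_mul, mul_zero, Finset.sum_const_zero, add_zero]
    rw [hadj, h1, h2, hT.diag, pathMatchingPoly]
    push_cast
    linear_combination (-(Complex.I ^ n * (pathMatchingPoly x n : ℂ))) * h01 -
      Complex.I ^ n * (pathMatchingPoly x n : ℂ) * Complex.I_sq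

theorem adjugate_zero_zero {x : ℝ} (hx : 0 < x) {T : Matrix (Fin (n + 1)) (Fin (n + 1)) ℂ}
    (hT : IsPathLike (Complex.I * x) T) :
    T.adjugate 0 0 = Complex.I ^ n * pathMatchingPoly x n := by
  rw [← det_eq hx hT.submatrix_succ]
  simp [adjugate_fin_succ_eq_det_submatrix]

theorem adjugate_last_last {x : ℝ} (hx : 0 < x) {T : Matrix (Fin (n + 1)) (Fin (n + 1)) ℂ}
    (hT : IsPathLike (Complex.I * x) T) :
    T.adjugate (Fin.last n) (Fin.last n) = Complex.I ^ n * pathMatchingPoly x n := by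
  rw [← det_eq hx hT.submatrix_castSucc]
  simp [adjugate_fin_succ_eq_det_submatrix, Fin.succAbove_last, ← two_mul]

/-- The relevant minor is lower triangular, with the superdiagonal of `T` as its diagonal. -/
theorem adjugate_zero_last {T : Matrix (Fin (n + 1)) (Fin (n + 1)) ℂ} (hT : IsPathLike z T) :
    T.adjugate 0 (Fin.last n) = (-1) ^ n * ∏ i : Fin n, T i.castSucc i.succ := by
  have h : (T.submatrix Fin.castSucc Fin.succ).det = ∏ i : Fin n, T i.castSucc i.succ := by
    rw [det_of_isLowerTriangular]
    · rfl
    · intro i j hij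
      exact hT.far _ _ (Or.inl (by simpa using hij))
  rw [adjugate_fin_succ_eq_det_submatrix, Fin.succAbove_last, ← h]
  simp [Fin.succAbove_zero]

theorem adjugate_last_zero {T : Matrix (Fin (n + 1)) (Fin (n + 1)) ℂ} (hT : IsPathLike z T) :
    T.adjugate (Fin.last n) 0 = (-1) ^ n * ∏ i : Fin n, T i.succ i.castSucc := by
  have h : IsPathLike z Tᵀ :=
    ⟨hT.diag, fun i j hij => hT.far j i hij.symm,
      fun i j hij => (mul_comm _ _).trans (hT.near i j hij)⟩
  simpa [← adjugate_transpose] using h.adjugate_zero_last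

end IsPathLike

/-- Matrices supported on the diagonal and on the edges of a cycle, with constant diagonal `z`, whose
symmetric pairs of entries on the edges have product `1`. -/
structure IsCycleLike (z : ℂ) {n : ℕ} (S : Matrix (Fin (n + 3)) (Fin (n + 3)) ℂ) : Prop where
  diag : ∀ i, S i i = z
  far : ∀ i j, i ≠ j → ¬ (SimpleGraph.cycleGraph (n + 3)).Adj i j → S i j = 0
  near : ∀ i j, (SimpleGraph.cycleGraph (n + 3)).Adj i j → S i j * S j i = 1

end Matrix

theorem SimpleGraph.cycleGraph_adj_iff_val {n : ℕ} (i j : Fin (n + 3)) :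
    (SimpleGraph.cycleGraph (n + 3)).Adj i j ↔ i.val + 1 = j.val ∨ j.val + 1 = i.val ∨
      (i.val = 0 ∧ j.val = n + 2) ∨ (j.val = 0 ∧ i.val = n + 2) := by
  have key (a b : Fin (n + 3)) :
      (a - b).val = 1 ↔ b.val + 1 = a.val ∨ (a.val = 0 ∧ b.val = n + 2) := by
    rcases le_or_gt b a with h | h
    · rw [Fin.sub_val_of_le h]
      have : b.val ≤ a.val := h
      omega
    · rw [Fin.coe_sub_iff_lt.2 h]
      have : a.val < b.val := h
      omega
  rw [SimpleGraph.cycleGraph_adj', key, key]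
  tauto

namespace Matrix.IsCycleLike

variable {z : ℂ} {n : ℕ} {S : Matrix (Fin (n + 3)) (Fin (n + 3)) ℂ}

theorem isPathLike_submatrix_succ (hS : IsCycleLike z S) :
    IsPathLike z (S.submatrix Fin.succ Fin.succ) where
  diag i := hS.diag _
  far i j h := hS.far _ _ (fun hij => by
      have := congrArg Fin.val hij
      simp at this
      omega) (by
    rw [SimpleGraph.cycleGraph_adj_iff_val]
    simp
    omega)
  near i j h := hS.near _ _ (by
    rw [SimpleGraph.cycleGraph_adj_iff_val]
    simp
    omega)

theorem adjugate_zero_zero {x : ℝ} (hx : 0 < x) (hS : IsCycleLike (Complex.I * x) S) :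
    S.adjugate 0 0 = Complex.I ^ (n + 2) * pathMatchingPoly x (n + 2) := by
  rw [← hS.isPathLike_submatrix_succ.det_eq hx]
  simp [adjugate_fin_succ_eq_det_submatrix]

/-- Vertex `0` meets only the two ends of the remaining path. The two diagonal cofactors there give
the matching terms; the two corner cofactors complete the cyclic products in the two orientations.
-/
theorem det_eq {x : ℝ} (hx : 0 < x) (hS : IsCycleLike (Complex.I * x) S) :
    S.det = Complex.I ^ (n + 3) *
        (x * pathMatchingPoly x (n + 2) + 2 * pathMatchingPoly x (n + 1) : ℝ) -
      (-1) ^ (n + 3) * (∏ i, S i (finRotate _ i) + ∏ i, S (finRotate _ i) i) := by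
  have hT := hS.isPathLike_submatrix_succ
  have hne : (S.submatrix Fin.succ Fin.succ).det ≠ 0 := by
    rw [hT.det_eq hx]
    exact mul_ne_zero (pow_ne_zero _ Complex.I_ne_zero)
      (Complex.ofReal_ne_zero.2 (pathMatchingPoly_pos hx _).ne')
  have hinner (i : Fin (n + 2)) (hi : i ≠ 0 ∧ i ≠ Fin.last (n + 1)) :
      ¬ (SimpleGraph.cycleGraph (n + 3)).Adj 0 i.succ := by
    have h0 : i.val ≠ 0 := fun h => hi.1 (Fin.ext h)
    have h1 : i.val ≠ n + 1 := fun h => hi.2 (Fin.ext h)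
    rw [SimpleGraph.cycleGraph_adj_iff_val]
    simp
    omega
  have hrow (i : Fin (n + 2)) (hi : i ≠ 0 ∧ i ≠ Fin.last (n + 1)) : S 0 i.succ = 0 :=
    hS.far _ _ (Fin.succ_ne_zero i).symm (hinner i hi)
  have hcol (i : Fin (n + 2)) (hi : i ≠ 0 ∧ i ≠ Fin.last (n + 1)) : S i.succ 0 = 0 :=
    hS.far _ _ (Fin.succ_ne_zero i) fun h => hinner i hi h.symm
  have h0l : (0 : Fin (n + 2)) ≠ Fin.last (n + 1) := (Fin.last_pos).ne
  have hsum (i : Fin (n + 2)) : ∑ j, S 0 i.succ * (S.submatrix Fin.succ Fin.succ).adjugate i j *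
      S j.succ 0 = S 0 i.succ * (S.submatrix Fin.succ Fin.succ).adjugate i 0 * S (Fin.succ 0) 0 +
        S 0 i.succ * (S.submatrix Fin.succ Fin.succ).adjugate i (Fin.last _) *
          S (Fin.last _).succ 0 :=
    Fintype.sum_eq_add _ _ h0l fun j hj => by rw [hcol j hj, mul_zero]
  have e0 := hS.near 0 (Fin.succ 0) (by rw [SimpleGraph.cycleGraph_adj_iff_val]; simp)
  have el := hS.near 0 (Fin.last (n + 1)).succ (by rw [SimpleGraph.cycleGraph_adj_iff_val]; simp)
  have hrot0 : finRotate (n + 3) 0 = Fin.succ 0 := by simp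
  have hrotl : finRotate (n + 3) (Fin.last (n + 1)).succ = 0 := by
    rw [Fin.succ_last, finRotate_last]
  have hrot (i : Fin (n + 1)) : finRotate (n + 3) i.castSucc.succ = i.succ.succ := by
    ext
    rw [coe_finRotate_of_ne_last]
    · simp
    · intro h
      have := congrArg Fin.val h
      simp at this
      omega
  have hprod (f : Fin (n + 3) → ℂ) : ∏ i, f i =
      f 0 * ((∏ i : Fin (n + 1), f i.castSucc.succ) * f (Fin.last (n + 1)).succ) := by
    rw [Fin.prod_univ_succ, Fin.prod_univ_castSucc]
  rw [det_succ_eq_sub_sum_adjugate S hne, Fintype.sum_eq_add _ _ h0l fun i hi => by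
    simp [hrow i hi], hsum, hsum, hT.adjugate_zero_zero hx, hT.adjugate_last_last hx,
    hT.adjugate_zero_last, hT.adjugate_last_zero, hT.det_eq hx, hS.diag, hprod, hprod,
    hrot0, hrotl]
  simp only [hrot, submatrix_apply]
  push_cast
  linear_combination (-(Complex.I ^ (n + 1) * (pathMatchingPoly x (n + 1) : ℂ))) * (e0 + el) -
    2 * Complex.I ^ (n + 1) * (pathMatchingPoly x (n + 1) : ℂ) * Complex.I_sq

end Matrix.IsCycleLike

/-! ### A path attached to a cycle -/

/-- The end of a path on `k` vertices attached to vertex `0` of a graph on `Fin (m + 3)`. -/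
def tailEnd (m : ℕ) : (k : ℕ) → Fin k ⊕ Fin (m + 3)
  | 0 => Sum.inr 0
  | _ + 1 => Sum.inl 0

namespace Matrix

/-- Matrices on a path with `k` vertices whose last vertex is attached to vertex `0` of the block `S`;
constant diagonal `z` on the path, and symmetric pairs of entries on its edges have product `1`. -/
structure IsTailLike (z : ℂ) {k m : ℕ} (S : Matrix (Fin (m + 3)) (Fin (m + 3)) ℂ)
    (R : Matrix (Fin k ⊕ Fin (m + 3)) (Fin k ⊕ Fin (m + 3)) ℂ) : Prop where
  diag : ∀ i, R (.inl i) (.inl i) = z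
  far : ∀ i j : Fin k, i.val + 1 < j.val ∨ j.val + 1 < i.val → R (.inl i) (.inl j) = 0
  near : ∀ i j : Fin k, i.val + 1 = j.val → R (.inl i) (.inl j) * R (.inl j) (.inl i) = 1
  far_right : ∀ i j, ¬ (i.val + 1 = k ∧ j = 0) →
    R (.inl i) (.inr j) = 0 ∧ R (.inr j) (.inl i) = 0
  near_right : ∀ i : Fin k, i.val + 1 = k → R (.inl i) (.inr 0) * R (.inr 0) (.inl i) = 1
  right : ∀ i j, R (.inr i) (.inr j) = S i j

/-- The determinant and the principal cofactor at the end of a path of length `k` attached to a block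
with determinant `d` and principal cofactor `e`. -/
def tailPair (z d e : ℂ) : ℕ → ℂ × ℂ
  | 0 => (d, e)
  | k + 1 => (z * (tailPair z d e k).1 - (tailPair z d e k).2, (tailPair z d e k).1)

/-- The first path vertex is a one-vertex block joined to the rest by a bridge; removing it gives
the recurrence. The block is invertible as `z ≠ 0`. -/
theorem IsTailLike.det_and_adjugate {z : ℂ} (hz : z ≠ 0) {m : ℕ}
    {S : Matrix (Fin (m + 3)) (Fin (m + 3)) ℂ} :
    ∀ {k : ℕ} {R : Matrix (Fin k ⊕ Fin (m + 3)) (Fin k ⊕ Fin (m + 3)) ℂ}, IsTailLike z S R →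
      R.det = (tailPair z S.det (S.adjugate 0 0) k).1 ∧
      R.adjugate (tailEnd m k) (tailEnd m k) = (tailPair z S.det (S.adjugate 0 0) k).2
  | 0, R, hR => by
    let e : Fin (m + 3) ≃ Fin 0 ⊕ Fin (m + 3) := (Equiv.emptySum _ _).symm
    have he : R.submatrix e e = S := by
      ext i j
      exact hR.right i j
    have hadj : R.adjugate (.inr 0) (.inr 0) = (R.submatrix e e).adjugate 0 0 := by
      rw [adjugate_submatrix_equiv_self]
      rfl
    exact ⟨by rw [← det_submatrix_equiv_self e R, he]; rfl, by rw [tailEnd, hadj, he]; rfl⟩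
  | k + 1, R, hR => by
    let f : Fin k ⊕ Fin (m + 3) → Fin (k + 1) ⊕ Fin (m + 3) := Sum.map Fin.succ id
    let e : Unit ⊕ (Fin k ⊕ Fin (m + 3)) ≃ Fin (k + 1) ⊕ Fin (m + 3) :=
      ((Equiv.sumAssoc _ _ _).symm.trans (Equiv.sumCongr
        ((Equiv.sumComm _ _).trans ((finSuccEquiv k).trans
          (Equiv.optionEquivSumPUnit (Fin k))).symm) (Equiv.refl _)))
    have hel (u : Unit) : e (.inl u) = .inl 0 := by simp [e]
    have her (u : Fin k ⊕ Fin (m + 3)) : e (.inr u) = f u := by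
      rcases u with u | u <;> simp [e, f]
    have hR' : IsTailLike z S (R.submatrix f f) := by
      refine ⟨fun i => hR.diag _, fun i j h => hR.far _ _ (by simpa using h),
        fun i j h => hR.near _ _ (by simpa using h), fun i j h => hR.far_right _ _ (by simpa using h),
        fun i h => hR.near_right _ (by simpa using h), fun i j => hR.right _ _⟩
    obtain ⟨ihd, iha⟩ := hR'.det_and_adjugate hz
    have hroot : R (.inl 0) (f (tailEnd m k)) * R (f (tailEnd m k)) (.inl 0) = 1 := by
      cases k with
      | zero => exact hR.near_right 0 rfl
      | succ k => exact hR.near 0 1 (by simp)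
    have hother (u : Fin k ⊕ Fin (m + 3)) (hu : u ≠ tailEnd m k) :
        R (.inl 0) (f u) = 0 ∧ R (f u) (.inl 0) = 0 := by
      rcases u with u | u
      · have hu0 : 0 < u.val := by
          cases k with
          | zero => exact u.elim0
          | succ k => exact Nat.pos_of_ne_zero fun h => hu (congrArg Sum.inl (Fin.ext h))
        exact ⟨hR.far _ _ (by simpa using hu0), hR.far _ _ (by simpa using hu0)⟩
      · refine hR.far_right _ _ fun h => ?_
        cases k with
        | zero => exact hu (congrArg Sum.inr h.2)
        | succ k => simp at h
    have he : R.submatrix e e = fromBlocks (of fun _ _ => z)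
        (Matrix.single () (tailEnd m k) (R (.inl 0) (f (tailEnd m k))))
        (Matrix.single (tailEnd m k) () (R (f (tailEnd m k)) (.inl 0))) (R.submatrix f f) := by
      ext (i | i) (j | j)
      · simp only [submatrix_apply, hel, fromBlocks_apply₁₁, of_apply]
        exact hR.diag 0
      · simp only [submatrix_apply, hel, her, fromBlocks_apply₁₂]
        rcases eq_or_ne j (tailEnd m k) with rfl | hj
        · simp
        · rw [(hother j hj).1]; simp [hj.symm]
      · simp only [submatrix_apply, hel, her, fromBlocks_apply₂₁]
        rcases eq_or_ne i (tailEnd m k) with rfl | hj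
        · simp
        · rw [(hother i hj).2]; simp [hj.symm]
      · simp only [submatrix_apply, her, fromBlocks_apply₂₂]
    have hz' : (of fun (_ _ : Unit) => z).det = z := by simp
    have hadj : R.adjugate (.inl 0) (.inl 0) = (R.submatrix e e).adjugate (.inl ()) (.inl ()) := by
      rw [adjugate_submatrix_equiv_self, submatrix_apply, hel]
    constructor
    · rw [← det_submatrix_equiv_self e R, he, det_fromBlocks_single _ _ _ _ _ _ (by rwa [hz']),
        hroot, hz', ihd, iha, adjugate_subsingleton (of fun (_ _ : Unit) => z)]
      simp [tailPair]
    · rw [tailEnd, hadj, he, adjugate_fromBlocks_inl_unit, ihd]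
      rfl

/-- The power of `i` in the determinant is one ahead of that in the cofactor, so the recurrence
becomes `a ↦ xa + e`, `q ↦ xq + q'`, without subtraction. The coefficients are chosen before `β`,
which makes different gain graphs comparable. -/
theorem tailPair_eq {x : ℝ} (hx : 0 < x) {c p : ℝ} (hc : 0 < c) (hp : 0 < p) (m : ℕ) :
    ∀ k : ℕ, ∃ a e q q' : ℝ, 0 < a ∧ 0 < e ∧ 0 < q ∧ 0 ≤ q' ∧ ∀ β : ℝ,
      tailPair (Complex.I * x) (Complex.I ^ (m + 3) * (c - 2 * β * Complex.I))
        (Complex.I ^ (m + 2) * p) k =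
        (Complex.I ^ (m + 3 + k) * (a - 2 * β * q * Complex.I),
          Complex.I ^ (m + 2 + k) * (e - 2 * β * q' * Complex.I))
  -- With no path vertex the cofactor deletes a vertex of the cycle and is free of `β`, hence `q' =
  -- 0`.
  | 0 => ⟨c, p, 1, 0, hc, hp, one_pos, le_rfl, fun β => by simp [tailPair]⟩
  | k + 1 => by
    obtain ⟨a, e, q, q', ha, he, hq, hq', h⟩ := tailPair_eq hx hc hp m k
    refine ⟨x * a + e, a, x * q + q', q, by positivity, ha, by positivity, hq.le, fun β => ?_⟩
    rw [tailPair, h]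
    refine Prod.ext ?_ ?_
    · push_cast
      have hp : Complex.I ^ (m + 3 + (k + 1)) = Complex.I ^ 2 * Complex.I ^ (m + 2 + k) := by ring
      have hp' : Complex.I ^ (m + 3 + k) = Complex.I * Complex.I ^ (m + 2 + k) := by ring
      simp only [hp, hp', Complex.I_sq]
      linear_combination (x * Complex.I ^ (m + 2 + k) * (a - 2 * β * q * Complex.I)) * Complex.I_sq
    · simp only
      ring

end Matrix

/-! ### Characteristic matrices of gain graphs -/

namespace UnitGainGraph

variable {V : Type*} {G : SimpleGraph V}

theorem adjMatrix_of_adj (Φ : UnitGainGraph G) {u v : V} (h : G.Adj u v) :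
    Φ.adjMatrix u v = Φ.gain ⟨(u, v), h⟩ := by
  simp [adjMatrix, h]

theorem adjMatrix_of_not_adj (Φ : UnitGainGraph G) {u v : V} (h : ¬ G.Adj u v) :
    Φ.adjMatrix u v = 0 := by
  simp [adjMatrix, h]

theorem gain_mul_gain (Φ : UnitGainGraph G) {u v : V} (h : G.Adj u v) :
    (Φ.gain ⟨(u, v), h⟩ : ℂ) * Φ.gain ⟨(v, u), h.symm⟩ = 1 := by
  have := Φ.gain_symm ⟨(u, v), h⟩
  rw [show (⟨(v, u), h.symm⟩ : G.Dart) = SimpleGraph.Dart.symm ⟨(u, v), h⟩ from rfl, this,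
    ← Circle.coe_mul, mul_inv_cancel, Circle.coe_one]

variable [Fintype V] [DecidableEq V]

/-- The characteristic matrix `z I - A(Φ)`. -/
noncomputable def charMat (Φ : UnitGainGraph G) (z : ℂ) : Matrix V V ℂ :=
  Matrix.scalar V z - Φ.adjMatrix

theorem charMat_diag (Φ : UnitGainGraph G) (z : ℂ) (u : V) : Φ.charMat z u u = z := by
  simp [charMat, Φ.adjMatrix_of_not_adj (G.loopless.irrefl u)]

theorem charMat_of_adj (Φ : UnitGainGraph G) (z : ℂ) {u v : V} (h : G.Adj u v) :
    Φ.charMat z u v = -Φ.gain ⟨(u, v), h⟩ := by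
  simp [charMat, Φ.adjMatrix_of_adj h, h.ne]

theorem charMat_of_not_adj (Φ : UnitGainGraph G) (z : ℂ) {u v : V} (huv : u ≠ v)
    (h : ¬ G.Adj u v) : Φ.charMat z u v = 0 := by
  simp [charMat, Φ.adjMatrix_of_not_adj h, huv]

theorem charMat_mul_charMat (Φ : UnitGainGraph G) (z : ℂ) {u v : V} (h : G.Adj u v) :
    Φ.charMat z u v * Φ.charMat z v u = 1 := by
  rw [Φ.charMat_of_adj z h, Φ.charMat_of_adj z h.symm, neg_mul_neg, gain_mul_gain]

theorem isCycleLike_charMat_submatrix (Φ : UnitGainGraph G) (z : ℂ) {n : ℕ}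
    (c : Fin (n + 3) → V) (hc : Function.Injective c)
    (hadj : ∀ i j, (SimpleGraph.cycleGraph (n + 3)).Adj i j ↔ G.Adj (c i) (c j)) :
    Matrix.IsCycleLike z ((Φ.charMat z).submatrix c c) where
  diag i := Φ.charMat_diag z _
  far i j hij h := Φ.charMat_of_not_adj z (hc.ne hij) (by rwa [← hadj])
  near i j h := Φ.charMat_mul_charMat z ((hadj i j).1 h)

/-- The two orientations have conjugate gains, so only the real part survives; the signs of the
entries `-φ` cancel the prefactor. -/
theorem prod_charMat_add_prod_charMat (Φ : UnitGainGraph G) (z : ℂ) {n : ℕ} (hn : 3 ≤ n + 3)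
    (c : SimpleGraph.Copy (SimpleGraph.cycleGraph (n + 3)) G) :
    (-1) ^ (n + 3) * (∏ i, Φ.charMat z (c i) (c (finRotate _ i)) +
      ∏ i, Φ.charMat z (c (finRotate _ i)) (c i)) = (2 * (Φ.cycleGain hn c : ℂ).re : ℝ) := by
  have hadj (i : Fin (n + 3)) := c.toHom.map_adj (cycleGraph_adj_finRotate hn i)
  have h1 : ∏ i, Φ.charMat z (c i) (c (finRotate _ i)) = (-1) ^ (n + 3) * (Φ.cycleGain hn c : ℂ) := by
    have hcoe (g : Fin (n + 3) → Circle) : ((∏ i, g i : Circle) : ℂ) = ∏ i, (g i : ℂ) :=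
      map_prod Circle.coeHom g _
    have hneg (g : Fin (n + 3) → ℂ) : ∏ i, -g i = (-1) ^ (n + 3) * ∏ i, g i := by
      simp [Finset.prod_neg]
    rw [cycleGain, hcoe, ← hneg]
    exact Finset.prod_congr rfl fun i _ => Φ.charMat_of_adj z (hadj i)
  have h2 : ∏ i, Φ.charMat z (c (finRotate _ i)) (c i) =
      (-1) ^ (n + 3) * (starRingEnd ℂ) (Φ.cycleGain hn c : ℂ) := by
    have h : (∏ i, Φ.charMat z (c i) (c (finRotate _ i))) *
        ∏ i, Φ.charMat z (c (finRotate _ i)) (c i) = 1 := by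
      rw [← Finset.prod_mul_distrib]
      exact Finset.prod_eq_one fun i _ => Φ.charMat_mul_charMat z (hadj i)
    rw [h1] at h
    rw [← Circle.coe_inv_eq_conj, Circle.coe_inv]
    have hs : ((-1 : ℂ) ^ (n + 3)) * (-1) ^ (n + 3) = 1 := by rw [← mul_pow]; simp
    have hg : (Φ.cycleGain hn c : ℂ) ≠ 0 := Circle.coe_ne_zero _
    field_simp
    linear_combination (-1) ^ (n + 3) * h -
      (Φ.cycleGain hn c : ℂ) * (∏ i, Φ.charMat z (c (finRotate _ i)) (c i)) * hs
  have hs : ((-1 : ℂ) ^ (n + 3)) * (-1) ^ (n + 3) = 1 := by rw [← mul_pow]; simp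
  rw [h1, h2, ← mul_add, ← mul_assoc, hs, one_mul, Complex.add_conj]

theorem energy_le_of_normSq_le {Φ Ψ : UnitGainGraph G} (h : ∀ x : ℝ, 0 < x →
    Complex.normSq (Φ.charMat (Complex.I * x)).det ≤ Complex.normSq (Ψ.charMat (Complex.I * x)).det) :
    Φ.energy ≤ Ψ.energy :=
  sum_abs_le_of_prod_le _ _ fun x hx => by
    simpa only [charMat, Matrix.IsHermitian.normSq_det_I_mul_sub (isHermitian_adjMatrix _)]
      using h x hx

theorem energy_lt_of_normSq_lt {Φ Ψ : UnitGainGraph G} (h : ∀ x : ℝ, 0 < x →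
    Complex.normSq (Φ.charMat (Complex.I * x)).det < Complex.normSq (Ψ.charMat (Complex.I * x)).det) :
    Φ.energy < Ψ.energy :=
  sum_abs_lt_of_prod_lt _ _ fun x hx => by
    simpa only [charMat, Matrix.IsHermitian.normSq_det_I_mul_sub (isHermitian_adjMatrix _)]
      using h x hx

end UnitGainGraph

/-! ### The characteristic determinant of the dumbbell -/

section DumbbellAdjacency

variable {n m ℓ : ℕ}

theorem dumbbellGraph_adj_inl_inr (hℓ : 1 ≤ ℓ) (i : Fin (n + 3)) (u : Fin (ℓ - 1) ⊕ Fin (m + 3)) :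
    (dumbbellGraph (n + 3) (m + 3) ℓ).Adj (.inl i) (.inr u) ↔
      i = 0 ∧ u = tailEnd m (ℓ - 1) := by
  obtain rfl | ⟨k, rfl⟩ : ℓ = 1 ∨ ∃ k, ℓ = k + 2 := by
    rcases eq_or_ne ℓ 1 with h | h
    · exact Or.inl h
    · exact Or.inr ⟨ℓ - 2, by omega⟩
  · rcases u with u | u
    · exact u.elim0
    · simp [dumbbellGraph, dumbbellAdj, tailEnd]
  · rcases u with u | u
    · simp only [dumbbellGraph, dumbbellAdj, Fin.val_eq_zero_iff]
      refine and_congr_right fun _ => ?_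
      exact ⟨fun h => congrArg Sum.inl (Fin.ext h), fun h => congrArg Fin.val (Sum.inl_injective h)⟩
    · simp [dumbbellGraph, dumbbellAdj, tailEnd]

theorem dumbbellGraph_adj_path (i j : Fin (ℓ - 1)) :
    (dumbbellGraph (n + 3) (m + 3) ℓ).Adj (.inr (.inl i)) (.inr (.inl j)) ↔
      i.val + 1 = j.val ∨ j.val + 1 = i.val :=
  SimpleGraph.pathGraph_adj

theorem dumbbellGraph_adj_path_right (i : Fin (ℓ - 1)) (j : Fin (m + 3)) :
    (dumbbellGraph (n + 3) (m + 3) ℓ).Adj (.inr (.inl i)) (.inr (.inr j)) ↔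
      i.val + 1 = ℓ - 1 ∧ j = 0 := by
  simp [dumbbellGraph, dumbbellAdj]

end DumbbellAdjacency

theorem mixedAlpha_le_one {r s ℓ : ℕ} (hr : 3 ≤ r) (Φ : UnitGainGraph (dumbbellGraph r s ℓ)) :
    mixedAlpha hr Φ ≤ 1 := by
  refine (le_abs_self _).trans ?_
  rw [mixedAlpha, abs_mul, abs_pow, abs_neg, abs_one, one_pow, one_mul]
  exact (Complex.abs_re_le_norm _).trans (Circle.norm_coe _).le

namespace UnitGainGraph

variable {n m ℓ : ℕ} (Φ : UnitGainGraph (dumbbellGraph (n + 3) (m + 3) ℓ)) (z : ℂ)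

theorem isTailLike_charMat_dumbbell : Matrix.IsTailLike z
    ((Φ.charMat z).submatrix (fun i => .inr (.inr i)) (fun i => .inr (.inr i)))
    ((Φ.charMat z).submatrix .inr .inr) where
  diag i := Φ.charMat_diag z _
  far i j h := Φ.charMat_of_not_adj z (fun hij => by
      have : i = j := Sum.inl_injective (Sum.inr_injective hij)
      subst this
      omega) (by
    rw [dumbbellGraph_adj_path]
    omega)
  near i j h := Φ.charMat_mul_charMat z ((dumbbellGraph_adj_path i j).2 (Or.inl h))
  far_right i j h := by
    have := mt (dumbbellGraph_adj_path_right (n := n) i j).1 h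
    exact ⟨Φ.charMat_of_not_adj z (by simp) this, Φ.charMat_of_not_adj z (by simp)
      fun h' => this h'.symm⟩
  near_right i h := Φ.charMat_mul_charMat z ((dumbbellGraph_adj_path_right i 0).2 ⟨h, rfl⟩)
  right _ _ := rfl

theorem charMat_dumbbell_eq_fromBlocks (hℓ : 1 ≤ ℓ) : ∃ b c : ℂ, b * c = 1 ∧
    Φ.charMat z = Matrix.fromBlocks ((Φ.charMat z).submatrix .inl .inl)
      (Matrix.single 0 (tailEnd m (ℓ - 1)) b) (Matrix.single (tailEnd m (ℓ - 1)) 0 c)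
      ((Φ.charMat z).submatrix .inr .inr) := by
  have hbridge := (dumbbellGraph_adj_inl_inr (n := n) (m := m) hℓ 0 _).2 ⟨rfl, rfl⟩
  refine ⟨_, _, Φ.charMat_mul_charMat z hbridge, ?_⟩
  have hzero (i : Fin (n + 3)) (u : Fin (ℓ - 1) ⊕ Fin (m + 3))
      (h : ¬ (i = 0 ∧ u = tailEnd m (ℓ - 1))) :
      ¬ (dumbbellGraph (n + 3) (m + 3) ℓ).Adj (.inl i) (.inr u) :=
    mt (dumbbellGraph_adj_inl_inr hℓ i u).1 h
  ext (i | i) (j | j)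
  · rfl
  · rw [Matrix.fromBlocks_apply₁₂, Matrix.single_apply]
    split_ifs with h
    · rw [← h.1, ← h.2]
    · exact Φ.charMat_of_not_adj z (by simp) (hzero i j fun h' => h ⟨h'.1.symm, h'.2.symm⟩)
  · rw [Matrix.fromBlocks_apply₂₁, Matrix.single_apply]
    split_ifs with h
    · rw [← h.1, ← h.2]
    · exact Φ.charMat_of_not_adj z (by simp)
        fun h' => hzero j i (fun h' => h ⟨h'.2.symm, h'.1.symm⟩) h'.symm
  · rfl

/-- After a common power of `i` is removed, the bridge formula has a real part free of `β` and an
imaginary part proportional to `β`. The constants depend on `x` but not on `Φ`. -/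
theorem exists_normSq_det_charMat_dumbbell (hr : 3 ≤ n + 3) (hs : 3 ≤ m + 3) (hℓ : 1 ≤ ℓ)
    (hr_even : Even (n + 3)) (hs_odd : Odd (m + 3)) {x : ℝ} (hx : 0 < x) :
    ∃ c p a e q q' : ℝ, 2 < c ∧ 0 < p ∧ 0 < a ∧ 0 < e ∧ 0 < q ∧ 0 ≤ q' ∧
      ∀ Φ : UnitGainGraph (dumbbellGraph (n + 3) (m + 3) ℓ),
        Complex.normSq (Φ.charMat (Complex.I * x)).det =
          ((c - 2 * mixedAlpha hr Φ) * a + p * e) ^ 2 +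
            4 * mixedBeta hs Φ ^ 2 * ((c - 2 * mixedAlpha hr Φ) * q + p * q') ^ 2 := by
  have hp := pathMatchingPoly_pos hx
  obtain ⟨a, e, q, q', ha, he, hq, hq', htail⟩ := Matrix.tailPair_eq hx
    (c := x * pathMatchingPoly x (m + 2) + 2 * pathMatchingPoly x (m + 1))
    (add_pos (mul_pos hx (hp _)) (mul_pos two_pos (hp _))) (hp (m + 2)) m (ℓ - 1)
  have hz : Complex.I * x ≠ 0 :=
    mul_ne_zero Complex.I_ne_zero (Complex.ofReal_ne_zero.2 hx.ne')
  have hc : 2 < x * pathMatchingPoly x (n + 2) + 2 * pathMatchingPoly x (n + 1) := by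
    obtain ⟨t, ht⟩ := hr_even
    have h1 := one_le_pathMatchingPoly_two_mul hx (t - 1)
    -- Here `n + 3 = 2t`, so `n + 1` is even and the matching polynomial is at least `1`.
    rw [show 2 * (t - 1) = n + 1 by omega] at h1
    have h2 := mul_pos hx (hp (n + 2))
    linarith
  refine ⟨_, pathMatchingPoly x (n + 2), a, e, q, q', hc, hp _, ha, he, hq, hq', fun Φ => ?_⟩
  have hL := Φ.isCycleLike_charMat_submatrix (Complex.I * x) (.inl : Fin (n + 3) → _)
    Sum.inl_injective fun i j => Iff.rfl
  have hS := Φ.isCycleLike_charMat_submatrix (Complex.I * x)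
    (fun i : Fin (m + 3) => .inr (.inr i)) (Sum.inr_injective.comp Sum.inr_injective)
    fun i j => Iff.rfl
  have hαI : Complex.I ^ (n + 3) = (-1) ^ ((n + 3) / 2) := by
    obtain ⟨t, ht⟩ := hr_even
    rw [ht, ← two_mul, pow_mul, Complex.I_sq, Nat.mul_div_cancel_left t two_pos]
  have hβI : Complex.I ^ (m + 3) * Complex.I = (-1) ^ ((m + 3 + 1) / 2) := by
    obtain ⟨t, ht⟩ := hs_odd
    rw [ht, ← pow_succ, show 2 * t + 1 + 1 = 2 * (t + 1) by ring, pow_mul, Complex.I_sq,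
      Nat.mul_div_cancel_left _ two_pos]
  have hsq (k : ℕ) : ((-1 : ℂ) ^ k) * (-1) ^ k = 1 := by rw [← mul_pow]; simp
  have hdetL : ((Φ.charMat (Complex.I * x)).submatrix Sum.inl Sum.inl).det =
      Complex.I ^ (n + 3) * ((x * pathMatchingPoly x (n + 2) + 2 * pathMatchingPoly x (n + 1) : ℝ)
        - 2 * mixedAlpha hr Φ) := by
    rw [hL.det_eq hx]
    have h := Φ.prod_charMat_add_prod_charMat (Complex.I * x) hr (dumbbellLeftCycle _ _ _)
    refine (congrArg _ h).trans ?_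
    rw [mixedAlpha, mul_sub, hαI]
    push_cast
    linear_combination 2 * ((Φ.cycleGain hr (dumbbellLeftCycle (n + 3) (m + 3) ℓ) : ℂ).re : ℂ) *
      hsq ((n + 3) / 2)
  have hdetS : ((Φ.charMat (Complex.I * x)).submatrix (fun i => .inr (.inr i))
      (fun i => .inr (.inr i))).det = Complex.I ^ (m + 3) *
        ((x * pathMatchingPoly x (m + 2) + 2 * pathMatchingPoly x (m + 1) : ℝ)
        - 2 * mixedBeta hs Φ * Complex.I) := by
    rw [hS.det_eq hx]
    have h := Φ.prod_charMat_add_prod_charMat (Complex.I * x) hs (dumbbellRightCycle _ _ _)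
    refine (congrArg _ h).trans ?_
    rw [mixedBeta]
    push_cast
    linear_combination 2 * ((Φ.cycleGain hs (dumbbellRightCycle (n + 3) (m + 3) ℓ) : ℂ).re : ℂ) *
      (hsq ((m + 3 + 1) / 2) + (-1) ^ ((m + 3 + 1) / 2) * hβI)
  obtain ⟨hdetR, hadjR⟩ := (Φ.isTailLike_charMat_dumbbell (Complex.I * x)).det_and_adjugate hz
  rw [hdetS, hS.adjugate_zero_zero hx, htail] at hdetR hadjR
  obtain ⟨b, c, hbc, hblocks⟩ := Φ.charMat_dumbbell_eq_fromBlocks (Complex.I * x) hℓ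
  have hne : ((Φ.charMat (Complex.I * x)).submatrix Sum.inl Sum.inl).det ≠ 0 := by
    rw [hdetL]
    refine mul_ne_zero (pow_ne_zero _ Complex.I_ne_zero) ?_
    have := mixedAlpha_le_one hr Φ
    exact_mod_cast (by linarith : (0 : ℝ) <
      x * pathMatchingPoly x (n + 2) + 2 * pathMatchingPoly x (n + 1) - 2 * mixedAlpha hr Φ).ne'
  set α := mixedAlpha hr Φ
  set β := mixedBeta hs Φ
  set C := x * pathMatchingPoly x (n + 2) + 2 * pathMatchingPoly x (n + 1)
  set p := pathMatchingPoly x (n + 2)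
  have hdet : (Φ.charMat (Complex.I * x)).det = Complex.I ^ (n + 3 + (m + 3 + (ℓ - 1))) *
      ((((C - 2 * α) * a + p * e : ℝ) : ℂ) +
        ((-(2 * β * ((C - 2 * α) * q + p * q')) : ℝ) : ℂ) * Complex.I) := by
    rw [hblocks, Matrix.det_fromBlocks_single _ _ _ _ _ _ hne, hbc, hdetL,
      hL.adjugate_zero_zero hx, hdetR, hadjR]
    push_cast
    have hI : Complex.I ^ (n + 3 + (m + 3 + (ℓ - 1))) =
        Complex.I ^ 2 * (Complex.I ^ (n + 2) * Complex.I ^ (m + 2 + (ℓ - 1))) := by ring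
    have hI' : Complex.I ^ (n + 3) * Complex.I ^ (m + 3 + (ℓ - 1)) =
        Complex.I ^ 2 * (Complex.I ^ (n + 2) * Complex.I ^ (m + 2 + (ℓ - 1))) := by ring
    rw [hI, Complex.I_sq]
    rw [Complex.I_sq] at hI'
    linear_combination (C - 2 * α : ℂ) * (a - 2 * β * q * Complex.I) * hI'
  rw [hdet, map_mul, map_pow, Complex.normSq_I, one_pow, one_mul, Complex.normSq_add_mul_I]
  ring

/-! ### Realising prescribed cycle gains -/

/-- Gains on a cycle, all equal to `1` except for `w` on the edge from the last vertex to vertex `0`. -/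
noncomputable def cycleEdgeGain (w : Circle) {k : ℕ} (i j : Fin (k + 3)) : Circle :=
  if i = Fin.last (k + 2) ∧ j = 0 then w else if i = 0 ∧ j = Fin.last (k + 2) then w⁻¹ else 1

theorem cycleEdgeGain_symm (w : Circle) {k : ℕ} (i j : Fin (k + 3)) :
    cycleEdgeGain w j i = (cycleEdgeGain w i j)⁻¹ := by
  unfold cycleEdgeGain
  have h : Fin.last (k + 2) ≠ 0 := Fin.last_pos.ne'
  by_cases h1 : i = Fin.last (k + 2) <;> by_cases h2 : j = 0 <;>
    by_cases h3 : i = 0 <;> by_cases h4 : j = Fin.last (k + 2) <;> simp_all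

theorem prod_cycleEdgeGain (w : Circle) (k : ℕ) :
    ∏ i : Fin (k + 3), cycleEdgeGain w i (finRotate _ i) = w := by
  rw [Fintype.prod_eq_single (Fin.last (k + 2))]
  · rw [finRotate_last, cycleEdgeGain, if_pos ⟨rfl, rfl⟩]
  · intro i hi
    rw [cycleEdgeGain, if_neg fun h => hi h.1, if_neg]
    rintro ⟨rfl, h⟩
    have := congrArg Fin.val h
    simp at this

/-- The gain graph on the dumbbell whose gains are `1` on the path, and whose cycles have gains `w`
and `w'`, concentrated on one edge. -/
noncomputable def ofCycleGains (n m ℓ : ℕ) (w w' : Circle) :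
    UnitGainGraph (dumbbellGraph (n + 3) (m + 3) ℓ) where
  gain d := match d.fst, d.snd with
    | .inl i, .inl j => cycleEdgeGain w i j
    | .inr (.inr i), .inr (.inr j) => cycleEdgeGain w' i j
    | _, _ => 1
  gain_symm := by
    rintro ⟨⟨i | i | i, j | j | j⟩, h⟩ <;>
      first | exact cycleEdgeGain_symm _ _ _ | exact inv_one.symm

end UnitGainGraph

theorem Circle.exists_coe_re_eq {t : ℝ} (ht : |t| ≤ 1) : ∃ w : Circle, (w : ℂ).re = t :=
  ⟨Circle.exp (Real.arccos t), by
    rw [Circle.coe_exp, Complex.exp_ofReal_mul_I_re,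
      Real.cos_arccos (abs_le.1 ht).1 (abs_le.1 ht).2]⟩

theorem exists_mixedAlpha_eq_one_mixedBeta_eq_zero {r s ℓ : ℕ} (hr : 3 ≤ r) (hs : 3 ≤ s) :
    ∃ Φ : UnitGainGraph (dumbbellGraph r s ℓ), mixedAlpha hr Φ = 1 ∧ mixedBeta hs Φ = 0 := by
  obtain ⟨n, rfl⟩ : ∃ n, r = n + 3 := ⟨r - 3, by omega⟩
  obtain ⟨m, rfl⟩ : ∃ m, s = m + 3 := ⟨s - 3, by omega⟩
  -- This real part equals the sign in `mixedAlpha`, so their product is `1`.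
  obtain ⟨w, hw⟩ := Circle.exists_coe_re_eq (t := (-1) ^ ((n + 3) / 2)) (by simp)
  obtain ⟨w', hw'⟩ := Circle.exists_coe_re_eq (t := 0) (by simp)
  refine ⟨UnitGainGraph.ofCycleGains n m ℓ w w', ?_, ?_⟩
  · have h : (UnitGainGraph.ofCycleGains n m ℓ w w').cycleGain hr (dumbbellLeftCycle _ _ _) = w :=
      UnitGainGraph.prod_cycleEdgeGain w n
    rw [mixedAlpha, h, hw, ← mul_pow]
    simp
  · have h : (UnitGainGraph.ofCycleGains n m ℓ w w').cycleGain hs (dumbbellRightCycle _ _ _) = w' :=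
      UnitGainGraph.prod_cycleEdgeGain w' m
    rw [mixedBeta, h, hw', mul_zero]

/-! ### The minimum and its uniqueness -/

section Minimum

variable {r s ℓ : ℕ} (hr : 3 ≤ r) (hs : 3 ≤ s) {Φ Ψ : UnitGainGraph (dumbbellGraph r s ℓ)}

theorem energy_le_of_mixedAlpha_eq_one (hℓ : 1 ≤ ℓ) (hr_even : Even r) (hs_odd : Odd s)
    (hα : mixedAlpha hr Φ = 1) (hβ : mixedBeta hs Φ = 0) :
    Φ.energy ≤ Ψ.energy := by
  obtain ⟨n, rfl⟩ : ∃ n, r = n + 3 := ⟨r - 3, by omega⟩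
  obtain ⟨m, rfl⟩ : ∃ m, s = m + 3 := ⟨s - 3, by omega⟩
  refine UnitGainGraph.energy_le_of_normSq_le fun x hx => ?_
  obtain ⟨c, p, a, e, q, q', hc, hp, ha, he, hq, hq', h⟩ :=
    UnitGainGraph.exists_normSq_det_charMat_dumbbell hr hs hℓ hr_even hs_odd hx
  rw [h, h, hα, hβ]
  have h1 := mixedAlpha_le_one hr Ψ
  have h2 : (c - 2 * 1) * a + p * e ≤ (c - 2 * mixedAlpha hr Ψ) * a + p * e := by gcongr
  have h3 : 0 ≤ (c - 2 * 1) * a + p * e := by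
    have : 0 < c - 2 * 1 := by linarith
    positivity
  have h4 := pow_le_pow_left₀ h3 h2 2
  have h5 : 0 ≤ 4 * mixedBeta hs Ψ ^ 2 * ((c - 2 * mixedAlpha hr Ψ) * q + p * q') ^ 2 := by
    positivity
  linarith

theorem energy_lt_of_mixedAlpha_eq_one (hℓ : 1 ≤ ℓ) (hr_even : Even r) (hs_odd : Odd s)
    (hα : mixedAlpha hr Φ = 1) (hβ : mixedBeta hs Φ = 0)
    (hΨ : ¬ (mixedAlpha hr Ψ = 1 ∧ mixedBeta hs Ψ = 0)) : Φ.energy < Ψ.energy := by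
  obtain ⟨n, rfl⟩ : ∃ n, r = n + 3 := ⟨r - 3, by omega⟩
  obtain ⟨m, rfl⟩ : ∃ m, s = m + 3 := ⟨s - 3, by omega⟩
  refine UnitGainGraph.energy_lt_of_normSq_lt fun x hx => ?_
  obtain ⟨c, p, a, e, q, q', hc, hp, ha, he, hq, hq', h⟩ :=
    UnitGainGraph.exists_normSq_det_charMat_dumbbell hr hs hℓ hr_even hs_odd hx
  rw [h, h, hα, hβ]
  have h1 := mixedAlpha_le_one hr Ψ
  have h3 : 0 ≤ (c - 2 * 1) * a + p * e := by
    have : 0 < c - 2 * 1 := by linarith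
    positivity
  have hpos : 0 < c - 2 * mixedAlpha hr Ψ := by linarith
  -- If `α < 1`, the first square is strictly larger for every `x`. If `α = 1`, then `β ≠ 0`, and
  -- the second term is positive because `c > 2` and `q > 0`.
  rcases h1.lt_or_eq with h1 | h1
  · have h2 : (c - 2 * 1) * a + p * e < (c - 2 * mixedAlpha hr Ψ) * a + p * e := by gcongr
    have h4 := pow_lt_pow_left₀ h2 h3 two_ne_zero
    have h5 : 0 ≤ 4 * mixedBeta hs Ψ ^ 2 * ((c - 2 * mixedAlpha hr Ψ) * q + p * q') ^ 2 := by
      positivity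
    linarith
  · have hb : mixedBeta hs Ψ ≠ 0 := fun hb => hΨ ⟨h1, hb⟩
    have h5 : 0 < 4 * mixedBeta hs Ψ ^ 2 * ((c - 2 * mixedAlpha hr Ψ) * q + p * q') ^ 2 := by
      positivity
    rw [h1] at h5 ⊢
    linarith

end Minimum

theorem mainTheorem8 (r s ℓ : ℕ) (hr : 3 ≤ r) (hs : 3 ≤ s) (hℓ : 1 ≤ ℓ)
    (hr_even : Even r) (hs_odd : Odd s) :
    (∃ Φ : UnitGainGraph (dumbbellGraph r s ℓ),
      ∀ Ψ : UnitGainGraph (dumbbellGraph r s ℓ), Φ.energy ≤ Ψ.energy) ∧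
    ∀ Φ : UnitGainGraph (dumbbellGraph r s ℓ),
      (∀ Ψ : UnitGainGraph (dumbbellGraph r s ℓ), Φ.energy ≤ Ψ.energy) ↔
        mixedAlpha hr Φ = 1 ∧ mixedBeta hs Φ = 0 := by
  obtain ⟨Φ₀, hα, hβ⟩ := exists_mixedAlpha_eq_one_mixedBeta_eq_zero (ℓ := ℓ) hr hs
  refine ⟨⟨Φ₀, fun Ψ => energy_le_of_mixedAlpha_eq_one hr hs hℓ hr_even hs_odd hα hβ⟩,
    fun Φ => ⟨fun h => ?_, fun h Ψ =>
      energy_le_of_mixedAlpha_eq_one hr hs hℓ hr_even hs_odd h.1 h.2⟩⟩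
  by_contra hΦ
  exact (h Φ₀).not_gt (energy_lt_of_mixedAlpha_eq_one hr hs hℓ hr_even hs_odd hα hβ hΦ)
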